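/- Let $K$ be a field of characteristic zero and let $\mathcal{A}$ be a finite set of lines in the projective plane $\mathbf{P}^2_K$ that have no point in common to all of them (that is, $\mathcal{A}$ is essential). Let $L_2(\mathcal{A})$ be the set of points of $\mathbf{P}^2_K$ that are intersections of lines of $\mathcal{A}$, and for $p \in L_2(\mathcal{A})$ let $\mathcal{A}_p$ be the set of lines of $\mathcal{A}$ through $p$. Suppose that $\mathcal{A}$ is supersolvable, i.e. there is a point $p \in L_2(\mathcal{A})$ such that for all distinct $H, L \in \mathcal{A} \setminus \mathcal{A}_p$ there is a unique line in $\mathcal{A}_p$ that contains the point $H \cap L$. Let $n_2(\mathcal{A})$ be the number of double points of $\mathcal{A}$, i.e. of points $q \in L_2(\mathcal{A})$ that lie on exactly two lines of $\mathcal{A}$. Then $$n_2(\mathcal{A}) \ge \frac{|\mathcal{A}|}{2}.$$ -/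

import Mathlib

namespace LineArrangement

variable {K : Type*} [Field K]

/-- A finite set of lines in `P²` over `K`, a line in `P²` being given by the linear plane
in `V = K³` that it is the projectivization of. -/
def IsLineArrangement (A : Finset (Submodule K (Fin 3 → K))) : Prop :=
  ∀ H ∈ A, Module.finrank K H = 2

/-- The intersection lattice: all intersections of subfamilies of `A`, the intersection of the
empty subfamily being `V`. -/
def intersectionLattice (A : Finset (Submodule K (Fin 3 → K))) :
    Set (Submodule K (Fin 3 → K)) :=
  {X | ∃ B : Finset (Submodule K (Fin 3 → K)), B ⊆ A ∧ X = B.inf id}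

/-- `A` is essential if the origin belongs to the intersection lattice. -/
def IsEssential (A : Finset (Submodule K (Fin 3 → K))) : Prop :=
  ⊥ ∈ intersectionLattice A

/-- The set `L₂(A)` of the elements of codimension two in the intersection lattice. These are
lines through the origin of `V = K³`, that is, points of `P²`; the point `p` lies on the line `H`
if and only if `p ≤ H`. -/
def points (A : Finset (Submodule K (Fin 3 → K))) : Set (Submodule K (Fin 3 → K)) :=
  {p | p ∈ intersectionLattice A ∧ Module.finrank K p = 1}

open Classical in
/-- The subarrangement `A_p` of the lines of `A` that pass through `p`. -/
noncomputable def linesThrough (A : Finset (Submodule K (Fin 3 → K)))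
    (p : Submodule K (Fin 3 → K)) : Finset (Submodule K (Fin 3 → K)) :=
  A.filter (fun H => p ≤ H)

/-- The Möbius function `μ(p) = |A_p| - 1` on the points of `A`. -/
noncomputable def moebius (A : Finset (Submodule K (Fin 3 → K)))
    (p : Submodule K (Fin 3 → K)) : ℤ :=
  ((linesThrough A p).card : ℤ) - 1

/-- The set of double points of `A`. -/
def doublePoints (A : Finset (Submodule K (Fin 3 → K))) : Set (Submodule K (Fin 3 → K)) :=
  {p | p ∈ points A ∧ moebius A p = 1}

/-- The number `n₂(A)` of double points (a finite number, see `doublePoints_finite`). -/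
noncomputable def numDoublePoints (A : Finset (Submodule K (Fin 3 → K))) : ℕ :=
  (doublePoints A).ncard

theorem doublePoints_finite (A : Finset (Submodule K (Fin 3 → K))) :
    (doublePoints A).Finite := by
  have h : (intersectionLattice A).Finite := by
    refine (A.powerset.finite_toSet.image (fun B => B.inf id)).subset ?_
    rintro X ⟨B, hB, rfl⟩
    exact ⟨B, by simpa using hB, rfl⟩
  exact h.subset fun p hp => hp.1.1

/-- `p ∈ L₂(A)` is a modular point if for any two distinct lines `H, L` of `A` not through `p`
there is a unique line of `A` through `p` that contains the point `H ∩ L`. -/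
def IsModularPoint (A : Finset (Submodule K (Fin 3 → K)))
    (p : Submodule K (Fin 3 → K)) : Prop :=
  p ∈ points A ∧ ∀ H ∈ A, H ∉ linesThrough A p → ∀ L ∈ A, L ∉ linesThrough A p → H ≠ L →
    ∃! M : Submodule K (Fin 3 → K), M ∈ linesThrough A p ∧ H ⊓ L ≤ M

/-- `A` is supersolvable if it has a modular point. -/
def IsSupersolvable (A : Finset (Submodule K (Fin 3 → K))) : Prop :=
  ∃ p, IsModularPoint A p

end LineArrangement

/-! The heart is that every line off the modular point `p` carries a double point. Take a line `W`
through `p` as line at infinity and `p` as the vertical direction. The other lines through `p`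
become x = a with a in S, the lines off `p` become graphs y = cx + d, and modularity says that two
graphs are parallel or cross over S. With Q = ∏ (x - a), `exists_tangent_field` builds, by Newton
interpolation, a field Q ∂/∂x + h ∂/∂y with deg h ≤ |S| that is tangent to all the graphs.

Suppose that y = 0 meets another graph at each of its crossings with `W` and the lines x = a.
Tangency to y = 0 gives h = yk, and the crossings over S force k(x, 0) = Q', with coefficient |S| at
x^(|S|-1). On a parallel y = d, k vanishes, yet that top coefficient is the same. So |S| = 0 in the
field, impossible in characteristic zero (`exists_simple_crossing`).

With m lines through `p` and r off it, each of the r lines thus has at least 1, and by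
`card_linesThrough_le` at least m + 1 - r, double points on lines through `p`. No such point is
counted twice, and r · max(1, m + 1 - r) ≥ (m + r)/2. -/

namespace LineArrangement

open Polynomial

/-! ### Bivariate polynomials of bounded total degree, restricted to lines -/

section Algebra

variable {F : Type*} [Field F]

/-- The bivariate polynomial `h`, in `y` over `F[x]`, has total degree less than `N`. -/
def TotalDegreeLT (N : ℕ) (h : F[X][X]) : Prop :=
  ∀ j n, N ≤ n + j → (h.coeff j).coeff n = 0

/-- The polynomial `c x + d` of which the line `y = c x + d` is the graph. -/
noncomputable def linePoly (f : F × F) : F[X] := C f.1 * X + C f.2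

theorem natDegree_linePoly_le (f : F × F) : (linePoly f).natDegree ≤ 1 :=
  natDegree_linear_le

theorem linePoly_injective : Function.Injective (linePoly (F := F)) := by
  intro f g h
  have h0 := congrArg (fun p => coeff p 0) h
  have h1 := congrArg (fun p => coeff p 1) h
  simp [linePoly] at h0 h1
  exact Prod.ext h1 h0

theorem coeff_linePoly_mul_zero (f : F × F) (p : F[X]) :
    (linePoly f * p).coeff 0 = f.2 * p.coeff 0 := by
  simp [linePoly, add_mul, mul_assoc]

theorem coeff_linePoly_mul_succ (f : F × F) (p : F[X]) (n : ℕ) :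
    (linePoly f * p).coeff (n + 1) = f.1 * p.coeff n + f.2 * p.coeff (n + 1) := by
  simp [linePoly, add_mul, mul_assoc, coeff_X_mul]

theorem coeff_linePoly_mul_eq_zero (f : F × F) {p : F[X]} {n : ℕ}
    (h : ∀ k, n ≤ k + 1 → p.coeff k = 0) : (linePoly f * p).coeff n = 0 := by
  cases n with
  | zero => rw [coeff_linePoly_mul_zero, h 0 (by omega), mul_zero]
  | succ n => rw [coeff_linePoly_mul_succ, h n (by omega), h (n + 1) (by omega)]; simp

theorem TotalDegreeLT.sub {N : ℕ} {g h : F[X][X]} (hg : TotalDegreeLT N g)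
    (hh : TotalDegreeLT N h) : TotalDegreeLT N (g - h) := by
  intro j n hn
  simp [hg j n hn, hh j n hn]

theorem totalDegreeLT_C {N : ℕ} {g : F[X]} (hg : ∀ n, N ≤ n → g.coeff n = 0) :
    TotalDegreeLT N (C g) := by
  intro j n hn
  rw [coeff_C]
  split_ifs with hj
  · exact hg n (by omega)
  · simp

theorem TotalDegreeLT.mul_line {N : ℕ} {h : F[X][X]} (hh : TotalDegreeLT N h) (f : F × F) :
    TotalDegreeLT (N + 1) (h * (X - C (linePoly f))) := by
  intro j n hn
  have h2 : (linePoly f * h.coeff j).coeff n = 0 :=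
    coeff_linePoly_mul_eq_zero f fun k hk => hh j k (by omega)
  rw [mul_sub, coeff_sub, coeff_mul_C, mul_comm (h.coeff j), coeff_sub, h2, sub_zero]
  cases j with
  | zero => simp
  | succ j => rw [coeff_mul_X]; exact hh j n (by omega)

theorem TotalDegreeLT.mul_prod_line {N : ℕ} {h : F[X][X]} (hh : TotalDegreeLT N h)
    (R : Finset (F × F)) :
    TotalDegreeLT (N + R.card) (h * ∏ i ∈ R, (X - C (linePoly i))) := by
  classical
  induction R using Finset.induction_on with
  | empty => simpa using hh
  | insert f R hf ih =>
    rw [Finset.prod_insert hf, Finset.card_insert_of_notMem hf, mul_comm (X - _), ← mul_assoc,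
      ← add_assoc]
    exact ih.mul_line f

/-- The y-coefficient of index j + 1 of the product is q_j - l q_(j+1), so the bounds descend from
the leading coefficient of `q`. -/
theorem TotalDegreeLT.of_mul_line {N : ℕ} {q : F[X][X]} {f : F × F}
    (h : TotalDegreeLT (N + 1) (q * (X - C (linePoly f)))) : TotalDegreeLT N q := by
  have key : ∀ t j, q.natDegree < j + t → ∀ n, N ≤ n + j → (q.coeff j).coeff n = 0 := by
    intro t
    induction t with
    | zero =>
      intro j hj n _
      rw [coeff_eq_zero_of_natDegree_lt (show q.natDegree < j from hj), coeff_zero]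
    | succ t ih =>
      intro j hj n hn
      have h1 := h (j + 1) n (by omega)
      have h2 : (linePoly f * q.coeff (j + 1)).coeff n = 0 :=
        coeff_linePoly_mul_eq_zero f fun k hk => ih (j + 1) (by omega) k (by omega)
      rwa [mul_sub, coeff_sub, coeff_mul_C, mul_comm (q.coeff _), coeff_sub, h2, sub_zero,
        coeff_mul_X] at h1
  exact fun j n hn => key (q.natDegree + 1) j (by omega) n hn

theorem TotalDegreeLT.of_mul_prod_line {N : ℕ} {q : F[X][X]} {R : Finset (F × F)}
    (h : TotalDegreeLT (N + R.card) (q * ∏ i ∈ R, (X - C (linePoly i)))) :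
    TotalDegreeLT N q := by
  classical
  induction R using Finset.induction_on with
  | empty => simpa using h
  | insert f R hf ih =>
    rw [Finset.prod_insert hf, Finset.card_insert_of_notMem hf, mul_comm (X - _), ← mul_assoc,
      ← add_assoc] at h
    exact ih h.of_mul_line

theorem TotalDegreeLT.coeff_eval {N : ℕ} {h : F[X][X]} (hh : TotalDegreeLT N h) (f : F × F)
    {n : ℕ} (hn : N ≤ n) : (h.eval (linePoly f)).coeff n = 0 := by
  rw [eval_eq_sum_range, finsetSum_coeff]
  refine Finset.sum_eq_zero fun j _ => ?_
  by_cases h0 : h.coeff j = 0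
  · simp [h0]
  have h1 : (h.coeff j).natDegree + j < N := by
    by_contra hc
    exact h0 (leadingCoeff_eq_zero.mp (hh j _ (by omega)))
  refine coeff_eq_zero_of_natDegree_lt ?_
  have h2 := natDegree_mul_le (p := h.coeff j) (q := linePoly f ^ j)
  have h3 := natDegree_pow_le_of_le j (natDegree_linePoly_le f)
  omega

/-- Distinct roots of a polynomial over a domain split off together. -/
theorem prod_line_dvd {P : F[X][X]} {R : Finset (F × F)}
    (h : ∀ i ∈ R, P.eval (linePoly i) = 0) : ∏ i ∈ R, (X - C (linePoly i)) ∣ P := by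
  classical
  by_cases hP : P = 0
  · simp [hP]
  have h1 : R.val.map linePoly ≤ P.roots := by
    rw [Multiset.le_iff_subset (R.nodup.map linePoly_injective)]
    intro a ha
    obtain ⟨i, hi, rfl⟩ := Multiset.mem_map.mp ha
    exact (mem_roots hP).mpr (h i hi)
  have h2 := (Multiset.prod_X_sub_C_dvd_iff_le_roots hP _).mpr h1
  rwa [Multiset.map_map] at h2

theorem eval_prod_line (R : Finset (F × F)) (f : F × F) :
    (∏ i ∈ R, (X - C (linePoly i))).eval (linePoly f) = ∏ i ∈ R, (linePoly f - linePoly i) := by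
  simp [eval_prod]

/-! ### The interpolation error at a further line -/

/-- The error made at a further line `f` is divisible by the product over the lines through a
common point of `f`. -/
theorem prod_dvd_of_concurrent {h : F[X][X]} {Q : F[X]} {R : Finset (F × F)} {f : F × F} {a : F}
    (ha : Q.eval a = 0) (hR : ∀ i ∈ R, h.eval (linePoly i) = C i.1 * Q)
    (hc : ∀ i ∈ R, i.1 * a + i.2 = f.1 * a + f.2) :
    ∏ i ∈ R, (linePoly f - linePoly i) ∣ h.eval (linePoly f) - C f.1 * Q := by
  obtain ⟨q, rfl⟩ := dvd_iff_isRoot.mpr ha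
  have hl : ∀ i : F × F, i.1 * a + i.2 = f.1 * a + f.2 →
      linePoly i - C (f.1 * a + f.2) = C i.1 * (X - C a) := by
    intro i hi
    rw [← hi, linePoly]
    simp only [C_add, C_mul]
    ring
  -- On a line of slope c through (a, b), c(x - a) = y - b; hence cQ is the restriction of the
  -- single polynomial (y - b)q.
  have h1 : ∏ i ∈ R, (X - C (linePoly i)) ∣ h - (X - C (C (f.1 * a + f.2))) * C q := by
    refine prod_line_dvd fun i hi => ?_
    simp only [eval_sub, eval_mul, eval_X, eval_C]
    rw [hR i hi, hl i (hc i hi)]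
    ring
  have h2 := eval_dvd (x := linePoly f) h1
  rw [eval_prod_line] at h2
  simp only [eval_sub, eval_mul, eval_X, eval_C] at h2
  rwa [hl f rfl, mul_assoc] at h2

theorem linePoly_sub_eq {f i : F × F} {a : F} (h : i.1 * a + i.2 = f.1 * a + f.2) :
    linePoly f - linePoly i = C (f.1 - i.1) * (X - C a) := by
  have h2 : f.2 = i.1 * a + i.2 - f.1 * a := by rw [h]; ring
  rw [linePoly, linePoly, h2]
  simp only [C_add, C_sub, C_mul]
  ring

theorem isCoprime_prod_linePoly_sub {f : F × F} {R T : Finset (F × F)} {a b : F} (hab : a ≠ b)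
    (hR : ∀ i ∈ R, i.1 ≠ f.1 ∧ i.1 * a + i.2 = f.1 * a + f.2)
    (hT : ∀ i ∈ T, i.1 ≠ f.1 ∧ i.1 * b + i.2 = f.1 * b + f.2) :
    IsCoprime (∏ i ∈ R, (linePoly f - linePoly i)) (∏ i ∈ T, (linePoly f - linePoly i)) := by
  refine IsCoprime.prod_left fun i hi => IsCoprime.prod_right fun j hj => ?_
  rw [linePoly_sub_eq (hR i hi).2, linePoly_sub_eq (hT j hj).2]
  have hu : ∀ {c : F}, c ≠ 0 → IsUnit (C c : F[X]) := fun hc =>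
    isUnit_C.mpr (isUnit_iff_ne_zero.mpr hc)
  rw [isCoprime_mul_unit_left_left (hu (sub_ne_zero.mpr (hR i hi).1.symm)),
    isCoprime_mul_unit_left_right (hu (sub_ne_zero.mpr (hT j hj).1.symm))]
  exact isCoprime_X_sub_C_of_isUnit_sub (isUnit_iff_ne_zero.mpr (sub_ne_zero.mpr hab))

/-- The error made at a further line `f` is divisible by the product over all the lines not
parallel to `f`. -/
theorem prod_dvd_of_not_parallel {h : F[X][X]} {S : Finset F} {R : Finset (F × F)} {f : F × F}
    (hR : ∀ i ∈ R, h.eval (linePoly i) = C i.1 * ∏ a ∈ S, (X - C a))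
    (hS : ∀ i ∈ R, i.1 ≠ f.1 ∧ ∃ a ∈ S, i.1 * a + i.2 = f.1 * a + f.2) :
    ∏ i ∈ R, (linePoly f - linePoly i) ∣
      h.eval (linePoly f) - C f.1 * ∏ a ∈ S, (X - C a) := by
  classical
  let g : F × F → F := fun i => (f.2 - i.2) / (i.1 - f.1)
  have hg : ∀ i ∈ R, ∀ a, i.1 * a + i.2 = f.1 * a + f.2 ↔ g i = a := by
    intro i hi a
    have := sub_ne_zero.mpr (hS i hi).1
    simp only [g]
    rw [div_eq_iff this]
    constructor <;> intro h <;> linear_combination (-1) * h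
  have hm : ∀ i ∈ R, g i ∈ S := by
    intro i hi
    obtain ⟨a, ha, h⟩ := (hS i hi).2
    rwa [(hg i hi a).mp h]
  -- Group the lines by the abscissa of their crossing with `f`; the groups give pairwise coprime
  -- factors.
  rw [← Finset.prod_fiberwise_of_maps_to hm]
  refine Finset.prod_dvd_of_coprime ?_ ?_
  · intro a _ b _ hab
    refine isCoprime_prod_linePoly_sub hab ?_ ?_ <;>
    · intro i hi
      obtain ⟨hi, h⟩ := Finset.mem_filter.mp hi
      exact ⟨(hS i hi).1, (hg i hi _).mpr h⟩
  · intro a ha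
    refine prod_dvd_of_concurrent (a := a) ?_ ?_ ?_
    · rw [eval_prod]
      exact Finset.prod_eq_zero ha (by simp)
    · exact fun i hi => hR i (Finset.mem_filter.mp hi).1
    · intro i hi
      obtain ⟨hi, h⟩ := Finset.mem_filter.mp hi
      exact (hg i hi _).mpr h

/-- The error made at a further line `f` has degree less than expected by the number of lines
parallel to `f`. -/
theorem coeff_eq_zero_of_parallel {N : ℕ} {h : F[X][X]} {Q : F[X]} {R : Finset (F × F)}
    {f : F × F} (hN : TotalDegreeLT N h) (hQ : ∀ n, N ≤ n → Q.coeff n = 0)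
    (hR : ∀ i ∈ R, i.1 = f.1 ∧ h.eval (linePoly i) = C i.1 * Q) {n : ℕ}
    (hn : N ≤ n + R.card) : (h.eval (linePoly f) - C f.1 * Q).coeff n = 0 := by
  have hd : ∏ i ∈ R, (X - C (linePoly i)) ∣ h - C (C f.1 * Q) := by
    refine prod_line_dvd fun i hi => ?_
    rw [eval_sub, eval_C, (hR i hi).2, (hR i hi).1, sub_self]
  obtain ⟨q, hq⟩ := hd
  have hT : TotalDegreeLT N (h - C (C f.1 * Q)) :=
    hN.sub (totalDegreeLT_C fun n hn => by simp [hQ n hn])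
  have hq' : TotalDegreeLT n q := by
    refine TotalDegreeLT.of_mul_prod_line (R := R) ?_
    rw [mul_comm, ← hq]
    exact fun j k hk => hT j k (by omega)
  have he := congrArg (eval (linePoly f)) hq
  rw [eval_sub, eval_C, eval_mul, eval_prod_line] at he
  have hp : ∏ i ∈ R, (linePoly f - linePoly i) = C (∏ i ∈ R, (f.2 - i.2)) := by
    rw [map_prod]
    refine Finset.prod_congr rfl fun i hi => ?_
    rw [linePoly, linePoly, (hR i hi).1, C_sub]
    ring
  rw [he, hp, coeff_C_mul, hq'.coeff_eval f le_rfl, mul_zero]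

/-! ### The tangent vector field and the characteristic zero argument -/

/-- Lines `y = c x + d` any two of which are parallel or meet over `S` are all tangent to a
polynomial vector field `Q(x) ∂/∂x + h(x, y) ∂/∂y`, where `Q = ∏ (x - a)` over `a ∈ S`, and `h` has
total degree at most `|S|`. -/
theorem exists_tangent_field (S : Finset F) (R : Finset (F × F))
    (hRS : ∀ f ∈ R, ∀ g ∈ R, f.1 ≠ g.1 → ∃ a ∈ S, f.1 * a + f.2 = g.1 * a + g.2) :
    ∃ h : F[X][X], TotalDegreeLT (S.card + 1) h ∧
      ∀ f ∈ R, h.eval (linePoly f) = C f.1 * ∏ a ∈ S, (X - C a) := by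
  classical
  induction R using Finset.induction_on with
  | empty => exact ⟨0, fun j n _ => by simp, by simp⟩
  | insert f R hf ih =>
    obtain ⟨h, hN, hR⟩ := ih fun i hi j hj =>
      hRS i (Finset.mem_insert_of_mem hi) j (Finset.mem_insert_of_mem hj)
    set Q : F[X] := ∏ a ∈ S, (X - C a) with hQdef
    have hQ : ∀ n, S.card + 1 ≤ n → Q.coeff n = 0 := fun n hn =>
      coeff_eq_zero_of_natDegree_lt (by rw [hQdef, natDegree_finsetProd_X_sub_C_eq_card]; omega)
    set E := h.eval (linePoly f) - C f.1 * Q with hE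
    have hdvd : ∏ i ∈ R with i.1 ≠ f.1, (linePoly f - linePoly i) ∣ E := by
      refine prod_dvd_of_not_parallel ?_ ?_
      · exact fun i hi => hR i (Finset.mem_filter.mp hi).1
      · intro i hi
        obtain ⟨hi, h⟩ := Finset.mem_filter.mp hi
        exact ⟨h, hRS i (Finset.mem_insert_of_mem hi) f (Finset.mem_insert_self _ _) h⟩
    have hdeg : ∀ n, S.card + 1 ≤ n + (R.filter (fun i => i.1 = f.1)).card → E.coeff n = 0 := by
      intro n hn
      refine coeff_eq_zero_of_parallel hN hQ ?_ hn
      intro i hi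
      obtain ⟨hi, h⟩ := Finset.mem_filter.mp hi
      exact ⟨h, hR i hi⟩
    obtain ⟨g, hg⟩ := hdvd
    have hpar : ∏ i ∈ R with i.1 = f.1, (linePoly f - linePoly i) =
        C (∏ i ∈ R with i.1 = f.1, (f.2 - i.2)) := by
      rw [map_prod]
      refine Finset.prod_congr rfl fun i hi => ?_
      rw [linePoly, linePoly, (Finset.mem_filter.mp hi).2, C_sub]
      ring
    set u := ∏ i ∈ R with i.1 = f.1, (f.2 - i.2) with hu
    have hu0 : u ≠ 0 := by
      refine Finset.prod_ne_zero_iff.mpr fun i hi h0 => ?_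
      obtain ⟨hi, h1⟩ := Finset.mem_filter.mp hi
      rw [← Prod.ext h1 (sub_eq_zero.mp h0).symm] at hf
      exact hf hi
    have hprod : ∏ i ∈ R, (linePoly f - linePoly i) =
        C u * ∏ i ∈ R with i.1 ≠ f.1, (linePoly f - linePoly i) := by
      rw [← hpar, Finset.prod_filter_mul_prod_filter_not]
    have hcard := Finset.card_filter_add_card_filter_not (s := R) (fun i => i.1 = f.1)
    -- Each line of `R` costs `g` one degree: the non-parallel ones by dividing `E`, the parallel
    -- ones by lowering the degree of `E`.
    have hgdeg : ∀ n, S.card + 1 ≤ n + R.card → g.coeff n = 0 := by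
      by_cases hg0 : g = 0
      · simp [hg0]
      have hnp : ∀ i ∈ R.filter (fun i => i.1 ≠ f.1), (linePoly f - linePoly i).natDegree = 1 := by
        intro i hi
        have h1 := sub_ne_zero.mpr (Finset.mem_filter.mp hi).2.symm
        have : linePoly f - linePoly i = C (f.1 - i.1) * X + C (f.2 - i.2) := by
          simp only [linePoly, C_sub]; ring
        rw [this, natDegree_linear h1]
      have hnp0 : ∀ i ∈ R.filter (fun i => i.1 ≠ f.1), linePoly f - linePoly i ≠ 0 := by
        intro i hi h0
        have := hnp i hi
        simp [h0] at this
      have hE0 : E ≠ 0 := by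
        rw [hg]
        exact mul_ne_zero (Finset.prod_ne_zero_iff.mpr hnp0) hg0
      have hEd : E.natDegree = (R.filter (fun i => i.1 ≠ f.1)).card + g.natDegree := by
        rw [hg, natDegree_mul (Finset.prod_ne_zero_iff.mpr hnp0) hg0, natDegree_prod _ _ hnp0,
          Finset.sum_congr rfl hnp]
        simp
      have hlt : E.natDegree + (R.filter (fun i => i.1 = f.1)).card < S.card + 1 := by
        by_contra hc
        exact hE0 (leadingCoeff_eq_zero.mp (hdeg _ (by omega)))
      intro n hn
      refine coeff_eq_zero_of_natDegree_lt ?_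
      simp only [ne_eq] at hEd
      omega
    -- Newton correction: it vanishes on the lines of `R` and restricts to `E` on `f`.
    refine ⟨h - C (C u⁻¹ * g) * ∏ i ∈ R, (X - C (linePoly i)), hN.sub ?_, ?_⟩
    · have h1 : TotalDegreeLT (S.card + 1 - R.card) (C (C u⁻¹ * g)) :=
        totalDegreeLT_C fun n hn => by rw [coeff_C_mul, hgdeg n (by omega), mul_zero]
      -- Beyond |S| + 1 lines the subtraction truncates, but then `g = 0` and no correction is made.
      by_cases hle : R.card ≤ S.card + 1
      · have h2 := h1.mul_prod_line R
        rwa [Nat.sub_add_cancel hle] at h2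
      · have : g = 0 := by
          ext n
          simpa using hgdeg n (by omega)
        intro j n _
        simp [this]
    · intro i hi
      rw [eval_sub, eval_mul, eval_C, eval_prod_line]
      rcases Finset.mem_insert.mp hi with rfl | hi
      · rw [hprod]
        have hcc : (C u⁻¹ * C u : F[X]) = 1 := by rw [← C_mul, inv_mul_cancel₀ hu0, C_1]
        have : C u⁻¹ * g * (C u * ∏ j ∈ R with j.1 ≠ i.1, (linePoly i - linePoly j)) = E := by
          rw [hg]
          linear_combination g * (∏ j ∈ R with j.1 ≠ i.1, (linePoly i - linePoly j)) * hcc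
        rw [this, hE]
        ring
      · rw [Finset.prod_eq_zero hi (sub_self (linePoly i)), mul_zero, sub_zero, hR i hi]

/-- Let lines `y = c x + d`, any two of which are parallel or meet over `S`, contain the line
`y = 0`. If the latter has a parallel among the others, then over some `a ∈ S` none of the
others meets it. -/
theorem exists_simple_crossing [CharZero F] {S : Finset F} {R : Finset (F × F)}
    (hS : S.Nonempty)
    (hRS : ∀ f ∈ R, ∀ g ∈ R, f.1 ≠ g.1 → ∃ a ∈ S, f.1 * a + f.2 = g.1 * a + g.2)
    (h0 : (0, 0) ∈ R) {d : F} (hd0 : d ≠ 0) (hd : (0, d) ∈ R) :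
    ∃ a ∈ S, ∀ f ∈ R, f ≠ (0, 0) → f.1 * a + f.2 ≠ 0 := by
  classical
  by_contra! hc
  obtain ⟨h, hN, hR⟩ := exists_tangent_field S R hRS
  have hz : linePoly ((0, 0) : F × F) = 0 := by simp [linePoly]
  have hX : h = X * h.divX := by
    have h1 := divX_mul_X_add h
    have h2 := hR _ h0
    rw [hz, ← coeff_zero_eq_eval_zero] at h2
    simp only [map_zero, zero_mul] at h2
    rw [h2, map_zero, add_zero, mul_comm] at h1
    exact h1.symm
  set k := h.divX with hk
  have hkN : TotalDegreeLT S.card k := by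
    refine TotalDegreeLT.of_mul_line (f := (0, 0)) ?_
    rwa [hz, map_zero, sub_zero, mul_comm, ← hX]
  have hQ' : k.coeff 0 = derivative (∏ a ∈ S, (X - C a)) := by
    -- Both sides have degree below |S|. A graph y = c(x - a) with c ≠ 0 gives k(x, c(x - a)) = Q/(x
    -- - a), whose value at a is Q'(a).
    refine eq_of_degrees_lt_of_eval_finset_eq S ?_ ?_ ?_
    · rw [degree_lt_iff_coeff_zero]
      exact fun n hn => hkN 0 n (by simpa using hn)
    · rw [degree_lt_iff_coeff_zero]
      intro n hn
      refine coeff_eq_zero_of_natDegree_lt (lt_of_le_of_lt (natDegree_derivative_le _) ?_)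
      rw [natDegree_finsetProd_X_sub_C_eq_card]
      have := hS.card_pos
      omega
    · intro a ha
      obtain ⟨f, hf, hf0, hfa⟩ := hc a ha
      have hf1 : f.1 ≠ 0 := by
        intro h1
        rw [h1, zero_mul, zero_add] at hfa
        exact hf0 (Prod.ext h1 hfa)
      have hl : linePoly f = C f.1 * (X - C a) := by
        have := linePoly_sub_eq (f := f) (i := (0, 0)) (a := a) (by simp [hfa])
        simpa [hz] using this
      have h1 := hR f hf
      rw [hX, eval_mul, eval_X, ← Finset.mul_prod_erase S _ ha] at h1
      nth_rewrite 1 [hl] at h1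
      rw [mul_assoc] at h1
      have h2 := mul_left_cancel₀ (X_sub_C_ne_zero a)
        (mul_left_cancel₀ (C_ne_zero.mpr hf1) h1)
      have h3 : (k.eval (linePoly f)).eval a = (k.coeff 0).eval a := by
        have h4 := eval_dvd (x := a) (sub_dvd_eval_sub (linePoly f) 0 k)
        rw [sub_zero, hl] at h4
        simp only [eval_mul, eval_C, eval_sub, eval_X, sub_self, mul_zero, zero_dvd_iff] at h4
        rw [coeff_zero_eq_eval_zero, hl]
        exact sub_eq_zero.mp h4
      rw [← h3, h2, ← Finset.mul_prod_erase S _ ha]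
      simp [derivative_mul]
  have hlead : (k.coeff 0).coeff (S.card - 1) = S.card := by
    have hm := monic_prod_X_sub_C (fun a : F => a) S
    have hnd := natDegree_finsetProd_X_sub_C_eq_card S (fun a : F => a)
    have hpos := hS.card_pos
    rw [hQ', coeff_derivative, Nat.sub_add_cancel hpos]
    rw [Monic, leadingCoeff, hnd] at hm
    rw [hm, one_mul]
    exact_mod_cast Nat.sub_add_cancel hpos
  have hdiv : TotalDegreeLT (S.card - 1) k.divX := by
    intro j n hn
    rw [coeff_divX]
    exact hkN _ _ (by omega)
  have hpar : k.eval (C d) = 0 := by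
    have h1 := hR _ hd
    rw [hX, eval_mul, eval_X] at h1
    simpa [linePoly, hd0] using h1
  -- k(x, d) - k(x, 0) is d times a polynomial of degree below |S| - 1, so the top coefficient |S|
  -- survives on y = d.
  have h1 := congrArg (fun p => (eval (C d) p).coeff (S.card - 1)) (divX_mul_X_add k)
  have h2 := hdiv.coeff_eval (0, d) le_rfl
  simp only [linePoly, map_zero, zero_mul, zero_add] at h2
  simp only [eval_add, eval_mul, eval_X, eval_C, coeff_add, coeff_mul_C, h2, hpar, hlead,
    zero_mul, zero_add, coeff_zero] at h1
  exact hS.card_pos.ne' (by exact_mod_cast h1)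

end Algebra

end LineArrangement

namespace LineArrangement

open Module

/-! ### Linear algebra of lines and points in K³ -/

section Geometry

variable {K : Type*} [Field K]

theorem eq_top_of_lt {H W : Submodule K (Fin 3 → K)} (hH : finrank K H = 2) (h : H < W) :
    W = ⊤ := by
  have h1 := Submodule.finrank_lt_finrank_of_lt h
  have h2 := Submodule.finrank_le W
  refine Submodule.eq_top_of_finrank_eq ?_
  simp only [finrank_fin_fun] at h2 ⊢
  omega

theorem finrank_inf_eq_one {H L : Submodule K (Fin 3 → K)} (hH : finrank K H = 2)
    (hL : finrank K L = 2) (h : H ≠ L) : finrank K (H ⊓ L : Submodule K (Fin 3 → K)) = 1 := by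
  have h1 := Submodule.finrank_sup_add_finrank_inf_eq H L
  have h2 : H ⊔ L = ⊤ := by
    refine eq_top_of_lt hH (lt_of_le_of_ne le_sup_left fun he => h ?_)
    exact (Submodule.eq_of_le_of_finrank_eq (sup_eq_left.mp he.symm) (by rw [hH, hL])).symm
  rw [h2, finrank_top, finrank_fin_fun, hH, hL] at h1
  omega

theorem inf_eq_of_le {p H L : Submodule K (Fin 3 → K)} (hp : finrank K p = 1)
    (hH : finrank K H = 2) (hL : finrank K L = 2) (h : H ≠ L) (hpH : p ≤ H) (hpL : p ≤ L) :
    H ⊓ L = p :=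
  (Submodule.eq_of_le_of_finrank_eq (le_inf hpH hpL)
    (by rw [hp, finrank_inf_eq_one hH hL h])).symm

theorem exists_span_singleton {p : Submodule K (Fin 3 → K)} (hp : finrank K p = 1) :
    ∃ v : Fin 3 → K, v ≠ 0 ∧ p = Submodule.span K {v} := by
  obtain ⟨v, hv, h⟩ := finrank_eq_one_iff'.mp hp
  refine ⟨v, by simpa using hv, le_antisymm (fun x hx => ?_) (by simp)⟩
  obtain ⟨c, hc⟩ := h ⟨x, hx⟩
  exact Submodule.mem_span_singleton.mpr ⟨c, congrArg Subtype.val hc⟩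

theorem exists_add_smul_mem {H : Submodule K (Fin 3 → K)} (hH : finrank K H = 2)
    {v : Fin 3 → K} (hv : v ∉ H) (e : Fin 3 → K) : ∃ c : K, e + c • v ∈ H := by
  have h : H ⊔ Submodule.span K {v} = ⊤ := by
    refine eq_top_of_lt hH (lt_of_le_of_ne le_sup_left fun he => hv ?_)
    rw [he]
    exact Submodule.mem_sup_right (Submodule.mem_span_singleton_self v)
  obtain ⟨l, hl, w, hw, hlw⟩ := Submodule.mem_sup.mp (h ▸ Submodule.mem_top (x := e))
  obtain ⟨c, rfl⟩ := Submodule.mem_span_singleton.mp hw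
  refine ⟨-c, ?_⟩
  rw [← hlw]
  simpa using hl

theorem smul_mem_eq_zero {H : Submodule K (Fin 3 → K)} {v : Fin 3 → K} (hv : v ∉ H) {c : K}
    (h : c • v ∈ H) : c = 0 := by
  by_contra hc
  exact hv ((Submodule.smul_mem_iff _ hc).mp h)

theorem add_smul_mem_unique {H : Submodule K (Fin 3 → K)} {v e : Fin 3 → K} (hv : v ∉ H)
    {c d : K} (hc : e + c • v ∈ H) (hd : e + d • v ∈ H) : c = d := by
  refine sub_eq_zero.mp (smul_mem_eq_zero hv ?_)
  have := H.sub_mem hc hd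
  rwa [add_sub_add_left_eq_sub, ← sub_smul] at this

theorem mem_linesThrough {A : Finset (Submodule K (Fin 3 → K))}
    {p H : Submodule K (Fin 3 → K)} : H ∈ linesThrough A p ↔ H ∈ A ∧ p ≤ H := by
  simp [linesThrough]

theorem one_lt_card_linesThrough {A : Finset (Submodule K (Fin 3 → K))}
    (hA : IsLineArrangement A) {p : Submodule K (Fin 3 → K)} (hp : p ∈ points A) :
    1 < (linesThrough A p).card := by
  obtain ⟨⟨B, hB, rfl⟩, h1⟩ := hp
  have hsub : B ⊆ linesThrough A (B.inf id) := fun H hH =>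
    mem_linesThrough.mpr ⟨hB hH, Finset.inf_le (f := id) hH⟩
  refine lt_of_lt_of_le ?_ (Finset.card_le_card hsub)
  by_contra! hc
  rcases Finset.card_le_one_iff_subset_singleton.mp hc with ⟨H, hH⟩
  rcases Finset.subset_singleton_iff.mp hH with rfl | rfl
  · rw [Finset.inf_empty, finrank_top, finrank_fin_fun] at h1
    omega
  · have := hA H (hB (Finset.mem_singleton_self H))
    rw [Finset.inf_singleton, id, this] at h1
    omega

/-! ### Passage to the affine chart -/

/-- The key property of a modular point in characteristic zero: every line missing it contains
a double point. -/
theorem IsModularPoint.exists_simple_crossing [CharZero K]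
    {A : Finset (Submodule K (Fin 3 → K))} (hA : IsLineArrangement A)
    {p : Submodule K (Fin 3 → K)} (hp : IsModularPoint A p) {L₀ : Submodule K (Fin 3 → K)}
    (hL₀ : L₀ ∈ A) (hpL₀ : ¬ p ≤ L₀) :
    ∃ V ∈ A, p ≤ V ∧ ∀ L ∈ A, ¬ p ≤ L → L₀ ⊓ V ≤ L → L = L₀ := by
  classical
  by_contra! hc
  obtain ⟨W, hW, V₁, hV₁, hWV₁⟩ := Finset.one_lt_card.mp (one_lt_card_linesThrough hA hp.1)
  rw [mem_linesThrough] at hW hV₁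
  obtain ⟨v, hv, hpv⟩ := exists_span_singleton hp.1.2
  have hple : ∀ H : Submodule K (Fin 3 → K), p ≤ H ↔ v ∈ H := fun H => by
    rw [hpv, Submodule.span_singleton_le_iff_mem]
  have hmod : ∀ L ∈ A, v ∉ L → ∀ L' ∈ A, v ∉ L' → L ≠ L' →
      ∃ M ∈ A, v ∈ M ∧ L ⊓ L' ≤ M := by
    intro L hL hvL L' hL' hvL' hne
    obtain ⟨M, ⟨hM, hle⟩, -⟩ := hp.2 L hL (by rw [mem_linesThrough, hple]; tauto) L' hL'
      (by rw [mem_linesThrough, hple]; tauto) hne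
    rw [mem_linesThrough, hple] at hM
    exact ⟨M, hM.1, hM.2, hle⟩
  simp only [hple] at hc hW hV₁ hpL₀
  have hWL : W ≠ L₀ := fun h => hpL₀ (h ▸ hW.2)
  obtain ⟨x, hx0, hx⟩ := exists_span_singleton (finrank_inf_eq_one (hA W hW.1) (hA _ hL₀) hWL)
  obtain ⟨hxW, hxL⟩ : x ∈ W ∧ x ∈ L₀ :=
    Submodule.mem_inf.mp (hx ▸ Submodule.mem_span_singleton_self x)
  obtain ⟨z, hzL, hzW⟩ : ∃ z ∈ L₀, z ∉ W := by
    refine Set.not_subset.mp fun h => hWL ?_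
    exact (Submodule.eq_of_le_of_finrank_eq h (by rw [hA W hW.1, hA _ hL₀])).symm
  have hspan : ∀ y, ∃ α β γ : K, y = α • x + β • v + γ • z := by
    intro y
    obtain ⟨γ, hγ⟩ := exists_add_smul_mem (hA W hW.1) hzW y
    obtain ⟨β, hβ⟩ := exists_add_smul_mem (hA _ hL₀) hpL₀ (y + γ • z)
    obtain ⟨α, hα⟩ := Submodule.mem_span_singleton.mp
      (hx ▸ Submodule.mem_inf.mpr ⟨W.add_mem hγ (W.smul_mem β hW.2), hβ⟩)
    exact ⟨α, -β, -γ, by rw [hα]; module⟩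
  have hxV : ∀ V ∈ A, v ∈ V → V ≠ W → x ∉ V := by
    intro V hV hvV hVW hxV
    have h1 : x ∈ p := by
      rw [← inf_eq_of_le hp.1.2 (hA V hV) (hA W hW.1) hVW ((hple V).mpr hvV) ((hple W).mpr hW.2)]
      exact ⟨hxV, hxW⟩
    rw [hpv] at h1
    obtain ⟨t, rfl⟩ := Submodule.mem_span_singleton.mp h1
    exact hx0 (by rw [smul_mem_eq_zero hpL₀ hxL, zero_smul])
  have hcd : ∀ L, ∃ f : K × K, L ∈ A → v ∉ L → x + f.1 • v ∈ L ∧ z + f.2 • v ∈ L := by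
    intro L
    by_cases h : L ∈ A ∧ v ∉ L
    · obtain ⟨c, hc⟩ := exists_add_smul_mem (hA L h.1) h.2 x
      obtain ⟨d, hd⟩ := exists_add_smul_mem (hA L h.1) h.2 z
      exact ⟨(c, d), fun _ _ => ⟨hc, hd⟩⟩
    · exact ⟨0, fun h1 h2 => absurd ⟨h1, h2⟩ h⟩
  choose f hf using hcd
  have ha : ∀ V, ∃ a : K, V ∈ A → v ∈ V → V ≠ W → z + a • x ∈ V := by
    intro V
    by_cases h : V ∈ A ∧ v ∈ V ∧ V ≠ W
    · obtain ⟨a, ha⟩ := exists_add_smul_mem (hA V h.1) (hxV V h.1 h.2.1 h.2.2) z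
      exact ⟨a, fun _ _ _ => ha⟩
    · exact ⟨0, fun h1 h2 h3 => absurd ⟨h1, h2, h3⟩ h⟩
  choose a ha using ha
  have hinj : ∀ L ∈ A, v ∉ L → ∀ L' ∈ A, v ∉ L' → f L = f L' → L ≤ L' := by
    intro L hL hvL L' hL' hvL' he y hy
    obtain ⟨α, β, γ, rfl⟩ := hspan y
    obtain ⟨h1, h2⟩ := hf L hL hvL
    obtain ⟨h3, h4⟩ := hf L' hL' hvL'
    have h5 : (β - α * (f L).1 - γ * (f L).2) • v ∈ L := by
      convert L.sub_mem hy (L.add_mem (L.smul_mem α h1) (L.smul_mem γ h2)) using 1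
      module
    have h6 := smul_mem_eq_zero hvL h5
    convert L'.add_mem (L'.smul_mem α h3) (L'.smul_mem γ h4) using 1
    rw [← he, show β = α * (f L).1 + γ * (f L).2 by linear_combination h6]
    module
  have hfL₀ : f L₀ = (0, 0) := by
    obtain ⟨h1, h2⟩ := hf L₀ hL₀ hpL₀
    exact Prod.ext (add_smul_mem_unique hpL₀ h1 (by simpa using hxL))
      (add_smul_mem_unique hpL₀ h2 (by simpa using hzL))
  have hne0 : ∀ L ∈ A, v ∉ L → L ≠ L₀ → f L ≠ (0, 0) := fun L hL hvL hne he =>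
    hne (le_antisymm (hinj L hL hvL L₀ hL₀ hpL₀ (he.trans hfL₀.symm))
      (hinj L₀ hL₀ hpL₀ L hL hvL (hfL₀.trans he.symm)))
  let R : Finset (K × K) := (A.filter fun L => v ∉ L).image f
  let S : Finset K := (A.filter fun V => v ∈ V ∧ V ≠ W).image a
  have hRmem : ∀ L ∈ A, v ∉ L → f L ∈ R := fun L hL hvL =>
    Finset.mem_image_of_mem f (Finset.mem_filter.mpr ⟨hL, hvL⟩)
  have hSmem : ∀ V ∈ A, v ∈ V → V ≠ W → a V ∈ S := fun V hV hvV hne =>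
    Finset.mem_image_of_mem a (Finset.mem_filter.mpr ⟨hV, hvV, hne⟩)
  have hRS : ∀ i ∈ R, ∀ j ∈ R, i.1 ≠ j.1 → ∃ b ∈ S, i.1 * b + i.2 = j.1 * b + j.2 := by
    intro i hi j hj hij
    obtain ⟨L, hL, rfl⟩ := Finset.mem_image.mp hi
    obtain ⟨L', hL', rfl⟩ := Finset.mem_image.mp hj
    obtain ⟨hL, hvL⟩ := Finset.mem_filter.mp hL
    obtain ⟨hL', hvL'⟩ := Finset.mem_filter.mp hL'
    obtain ⟨M, hM, hvM, hle⟩ := hmod L hL hvL L' hL' hvL' (fun h => hij (by rw [h]))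
    obtain ⟨b, hb⟩ : ∃ b, (f L).1 * b + (f L).2 = (f L').1 * b + (f L').2 := by
      refine ⟨((f L').2 - (f L).2) / ((f L).1 - (f L').1), ?_⟩
      have := sub_ne_zero.mpr hij
      field_simp
      ring
    obtain ⟨h1, h2⟩ := hf L hL hvL
    obtain ⟨h3, h4⟩ := hf L' hL' hvL'
    have h5 : z + b • x + ((f L).1 * b + (f L).2) • v ∈ L := by
      convert L.add_mem h2 (L.smul_mem b h1) using 1
      module
    have h6 : z + b • x + ((f L).1 * b + (f L).2) • v ∈ L' := by
      rw [hb]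
      convert L'.add_mem h4 (L'.smul_mem b h3) using 1
      module
    have h7 : z + b • x ∈ M := (M.add_mem_iff_left (M.smul_mem _ hvM)).mp (hle ⟨h5, h6⟩)
    have hMW : M ≠ W := by
      rintro rfl
      exact hzW ((M.add_mem_iff_left (M.smul_mem _ hxW)).mp h7)
    rw [add_smul_mem_unique (hxV M hM hvM hMW) h7 (ha M hM hvM hMW)] at hb
    exact ⟨a M, hSmem M hM hvM hMW, hb⟩
  obtain ⟨L', hL', hvL', hle', hne'⟩ := hc W hW.1 hW.2
  have hf' : f L' = (0, (f L').2) :=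
    Prod.ext (add_smul_mem_unique hvL' (hf L' hL' hvL').1
      (by simpa using hle' ⟨hxL, hxW⟩)) rfl
  obtain ⟨b, hb, hcross⟩ := LineArrangement.exists_simple_crossing (S := S) (R := R)
    ⟨a V₁, hSmem V₁ hV₁.1 hV₁.2 hWV₁.symm⟩ hRS (hfL₀ ▸ hRmem L₀ hL₀ hpL₀)
    (d := (f L').2) (fun h => hne0 L' hL' hvL' hne' (by rw [hf', h]))
    (hf' ▸ hRmem L' hL' hvL')
  obtain ⟨V, hV, rfl⟩ := Finset.mem_image.mp hb
  obtain ⟨hV, hvV, hVW⟩ := Finset.mem_filter.mp hV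
  obtain ⟨L, hL, hvL, hle, hne⟩ := hc V hV hvV
  refine hcross (f L) (hRmem L hL hvL) (hne0 L hL hvL hne) (smul_mem_eq_zero hvL ?_)
  obtain ⟨h1, h2⟩ := hf L hL hvL
  have h3 : z + a V • x ∈ L := hle ⟨L₀.add_mem hzL (L₀.smul_mem _ hxL), ha V hV hvV hVW⟩
  convert L.sub_mem (L.add_mem h2 (L.smul_mem (a V) h1)) h3 using 1
  module

theorem inf_mem_doublePoints {A : Finset (Submodule K (Fin 3 → K))} (hA : IsLineArrangement A)
    {p V L : Submodule K (Fin 3 → K)} (hp : finrank K p = 1) (hV : V ∈ A) (hpV : p ≤ V)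
    (hL : L ∈ A) (hpL : ¬ p ≤ L) (h : ∀ L' ∈ A, ¬ p ≤ L' → L ⊓ V ≤ L' → L' = L) :
    L ⊓ V ∈ doublePoints A ∧ linesThrough A (L ⊓ V) = {L, V} := by
  classical
  have hne : L ≠ V := fun he => hpL (he ▸ hpV)
  have h1 := finrank_inf_eq_one (hA L hL) (hA V hV) hne
  have hlines : linesThrough A (L ⊓ V) = {L, V} := by
    ext M
    rw [mem_linesThrough, Finset.mem_insert, Finset.mem_singleton]
    constructor
    · rintro ⟨hM, hle⟩
      by_cases hpM : p ≤ M
      · right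
        by_contra hMV
        have h2 := inf_eq_of_le hp (hA M hM) (hA V hV) hMV hpM hpV
        have h3 : L ⊓ V = p := Submodule.eq_of_le_of_finrank_eq
          (h2 ▸ le_inf hle inf_le_right) (by rw [h1, hp])
        exact hpL (h3 ▸ inf_le_left)
      · exact Or.inl (h M hM hpM hle)
    · rintro (rfl | rfl)
      exacts [⟨hL, inf_le_left⟩, ⟨hV, inf_le_right⟩]
  refine ⟨⟨⟨⟨{L, V}, ?_, by simp⟩, h1⟩, ?_⟩, hlines⟩
  · intro M hM
    rcases Finset.mem_insert.mp hM with rfl | hM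
    · exact hL
    · rwa [Finset.mem_singleton.mp hM]
  · rw [moebius, hlines, Finset.card_pair hne]
    norm_num

/-- On a line `L` missing `p`, each of the other lines missing `p` spoils at most one of the
crossings of `L` with the lines through `p`. -/
theorem card_linesThrough_le {A : Finset (Submodule K (Fin 3 → K))} (hA : IsLineArrangement A)
    {p L : Submodule K (Fin 3 → K)} (hp : finrank K p = 1) (hL : L ∈ A) (hpL : ¬ p ≤ L)
    [DecidablePred fun H : Submodule K (Fin 3 → K) => p ≤ H]
    [DecidablePred fun V => ∀ L' ∈ A, ¬ p ≤ L' → L ⊓ V ≤ L' → L' = L] :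
    (linesThrough A p).card + 1 ≤
      ((linesThrough A p).filter fun V => ∀ L' ∈ A, ¬ p ≤ L' → L ⊓ V ≤ L' → L' = L).card +
        (A.filter fun H => ¬ p ≤ H).card := by
  classical
  rw [← Finset.card_filter_add_card_filter_not (s := linesThrough A p)
    (fun V => ∀ L' ∈ A, ¬ p ≤ L' → L ⊓ V ≤ L' → L' = L), add_assoc]
  refine Nat.add_le_add_left ?_ _
  have hmem : L ∈ A.filter fun H => ¬ p ≤ H := Finset.mem_filter.mpr ⟨hL, hpL⟩
  rw [← Finset.card_erase_add_one hmem]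
  refine Nat.add_le_add_right ?_ _
  have hex : ∀ V, ∃ L', (¬ ∀ L' ∈ A, ¬ p ≤ L' → L ⊓ V ≤ L' → L' = L) →
      L' ∈ A ∧ ¬ p ≤ L' ∧ L ⊓ V ≤ L' ∧ L' ≠ L := by
    intro V
    by_cases h : ∀ L' ∈ A, ¬ p ≤ L' → L ⊓ V ≤ L' → L' = L
    · exact ⟨L, fun h' => absurd h h'⟩
    · push Not at h
      obtain ⟨L', h'⟩ := h
      exact ⟨L', fun _ => h'⟩
  choose g hg using hex
  refine Finset.card_le_card_of_injOn g ?_ ?_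
  · intro V hV
    obtain ⟨h1, h2, -, h4⟩ := hg V (Finset.mem_filter.mp hV).2
    exact Finset.mem_erase.mpr ⟨h4, Finset.mem_filter.mpr ⟨h1, h2⟩⟩
  · intro V hV V' hV' he
    obtain ⟨hV, hnV⟩ := Finset.mem_filter.mp hV
    obtain ⟨hV', hnV'⟩ := Finset.mem_filter.mp hV'
    rw [mem_linesThrough] at hV hV'
    obtain ⟨h1, h2, h3, h4⟩ := hg V hnV
    obtain ⟨-, -, h3', -⟩ := hg V' hnV'
    have key : ∀ U ∈ A, p ≤ U → L ⊓ U ≤ g V → L ⊓ U = L ⊓ g V := by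
      intro U hU hpU hle
      refine Submodule.eq_of_le_of_finrank_eq (le_inf inf_le_left hle) ?_
      rw [finrank_inf_eq_one (hA L hL) (hA U hU) (fun h => hpL (h ▸ hpU)),
        finrank_inf_eq_one (hA L hL) (hA _ h1) h4.symm]
    by_contra hne
    have h5 := inf_eq_of_le hp (hA V hV.1) (hA V' hV'.1) hne hV.2 hV'.2
    have h6 := key V hV.1 hV.2 h3
    have h7 := key V' hV'.1 hV'.2 (he ▸ h3')
    have h8 : L ⊓ V = p := by
      refine Submodule.eq_of_le_of_finrank_eq ?_ ?_
      · rw [← h5]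
        exact le_inf inf_le_right ((h6.trans h7.symm).le.trans inf_le_right)
      · rw [finrank_inf_eq_one (hA L hL) (hA V hV.1) (fun h => hpL (h ▸ hV.2)), hp]
    exact hpL (h8 ▸ inf_le_left)

theorem IsEssential.exists_not_le {A : Finset (Submodule K (Fin 3 → K))} (h : IsEssential A)
    {p : Submodule K (Fin 3 → K)} (hp : finrank K p = 1) : ∃ L ∈ A, ¬ p ≤ L := by
  by_contra! hc
  obtain ⟨B, hB, hbot⟩ := h
  have h1 : p ≤ B.inf id := Finset.le_inf fun H hH => hc H (hB hH)
  rw [← hbot, le_bot_iff] at h1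
  subst h1
  rw [finrank_bot] at hp
  omega

theorem card_le_two_mul_numDoublePoints [CharZero K] {A : Finset (Submodule K (Fin 3 → K))}
    (hA : IsLineArrangement A) (hess : IsEssential A) {p : Submodule K (Fin 3 → K)}
    (hp : IsModularPoint A p) : A.card ≤ 2 * numDoublePoints A := by
  classical
  let Vs := linesThrough A p
  let Ls := A.filter fun H => ¬ p ≤ H
  let D : Submodule K (Fin 3 → K) → Finset (Submodule K (Fin 3 → K)) := fun L =>
    Vs.filter fun V => ∀ L' ∈ A, ¬ p ≤ L' → L ⊓ V ≤ L' → L' = L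
  have hcard : Vs.card + Ls.card = A.card := by
    simpa [Vs, Ls, linesThrough] using
      Finset.card_filter_add_card_filter_not (s := A) (fun H => p ≤ H)
  have hone : ∀ L ∈ Ls, 1 ≤ (D L).card := by
    intro L hL
    obtain ⟨hL, hpL⟩ := Finset.mem_filter.mp hL
    obtain ⟨V, hV, hpV, h⟩ := hp.exists_simple_crossing hA hL hpL
    exact Finset.card_pos.mpr ⟨V, Finset.mem_filter.mpr ⟨mem_linesThrough.mpr ⟨hV, hpV⟩, h⟩⟩
  have hmany : ∀ L ∈ Ls, Vs.card + 1 - Ls.card ≤ (D L).card := by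
    intro L hL
    obtain ⟨hL, hpL⟩ := Finset.mem_filter.mp hL
    have := card_linesThrough_le hA hp.1.2 hL hpL
    simp only [D, Vs, Ls]
    omega
  have hdouble : ∀ x ∈ Ls.sigma D, x.1 ⊓ x.2 ∈ doublePoints A ∧
      linesThrough A (x.1 ⊓ x.2) = {x.1, x.2} ∧ ¬ p ≤ x.1 ∧ p ≤ x.2 := by
    rintro ⟨L, V⟩ hx
    obtain ⟨hL, hV⟩ := Finset.mem_sigma.mp hx
    obtain ⟨hL, hpL⟩ := Finset.mem_filter.mp hL
    obtain ⟨hV, h⟩ := Finset.mem_filter.mp hV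
    obtain ⟨hV, hpV⟩ := mem_linesThrough.mp hV
    obtain ⟨h1, h2⟩ := inf_mem_doublePoints hA hp.1.2 hV hpV hL hpL h
    exact ⟨h1, h2, hpL, hpV⟩
  have hn : ∑ L ∈ Ls, (D L).card ≤ numDoublePoints A := by
    rw [← Finset.card_sigma, numDoublePoints, Set.ncard_eq_toFinset_card _ (doublePoints_finite A)]
    refine Finset.card_le_card_of_injOn (fun x => x.1 ⊓ x.2) ?_ ?_
    · intro x hx
      simpa using (hdouble x hx).1
    · intro x hx y hy he
      obtain ⟨-, h1, h2, h3⟩ := hdouble x hx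
      obtain ⟨-, h4, h5, h6⟩ := hdouble y hy
      simp only at he
      have h7 : ({x.1, x.2} : Finset (Submodule K (Fin 3 → K))) = {y.1, y.2} := by
        rw [← h1, ← h4, he]
      have h8 : x.1 ∈ ({y.1, y.2} : Finset (Submodule K (Fin 3 → K))) := by simp [← h7]
      have h9 : x.2 ∈ ({y.1, y.2} : Finset (Submodule K (Fin 3 → K))) := by simp [← h7]
      rw [Finset.mem_insert, Finset.mem_singleton] at h8 h9
      refine Sigma.ext (h8.resolve_right fun h => h2 (h ▸ h6)) (heq_of_eq ?_)
      exact h9.resolve_left fun h => h5 (h ▸ h3)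
  have hr : 1 ≤ Ls.card := by
    obtain ⟨L, hL, hpL⟩ := hess.exists_not_le hp.1.2
    exact Finset.card_pos.mpr ⟨L, Finset.mem_filter.mpr ⟨hL, hpL⟩⟩
  have h1 := Finset.card_nsmul_le_sum Ls _ _ hone
  have h2 := Finset.card_nsmul_le_sum Ls _ _ hmany
  rw [smul_eq_mul] at h1 h2
  rcases le_total Vs.card Ls.card with hle | hle
  · omega
  · obtain ⟨k, hk⟩ := Nat.exists_eq_add_of_le hle
    obtain ⟨r, hr'⟩ := Nat.exists_eq_add_of_le hr
    have h3 : Vs.card + 1 - Ls.card = k + 1 := by omega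
    rw [h3, hr'] at h2
    nlinarith [Nat.zero_le (r * k)]

end Geometry

end LineArrangement

theorem theorem1p3 {K : Type*} [Field K] [CharZero K]
    (A : Finset (Submodule K (Fin 3 → K)))
    (hA : LineArrangement.IsLineArrangement A)
    (hess : LineArrangement.IsEssential A)
    (hss : LineArrangement.IsSupersolvable A) :
    (LineArrangement.numDoublePoints A : ℚ) ≥ (A.card : ℚ) / 2 := by
  obtain ⟨p, hp⟩ := hss
  have h := LineArrangement.card_le_two_mul_numDoublePoints hA hess hp
  have h' : (A.card : ℚ) ≤ 2 * LineArrangement.numDoublePoints A := by exact_mod_cast h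
  linarith
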